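/- **Setting.** Let $n\ge 1$, $i\in\{1,\dots,n\}$, let $\chi_j\subset\mathbb R^{N_j}$ ($j=1,\dots,n$) be open, $U\subset\mathbb R^M$ closed, $\chi=\chi_1\times\dots\times\chi_n$, let $C_i,D_i\subset\chi\times U$ be relatively closed in $\chi\times U$, and let $f_i:C_i\to\mathbb R^{N_i}$, $g_i:D_i\to\chi_i$ be continuous. Consider the hybrid subsystem $$\dot x_i=f_i(x_1,\dots,x_n,u)\ \text{ on } C_i,\qquad x_i^+=g_i(x_1,\dots,x_n,u)\ \text{ on } D_i ,$$ with state $x_i$ and inputs $x_j$ ($j\ne i$) and $u$. *Solutions.* A hybrid time domain is a union of intervals $[t_k,t_{k+1}]\times\{k\}$, over all $k\ge 0$ or over finitely many $k=0,\dots,K$, with $0=t_0\le t_1\le\dots$; in the finite case the last interval may be $[t_K,T)\times\{K\}$, $t_K<T\le\infty$. A solution pair on a hybrid time domain $E$ consists of a hybrid arc $x_i:E\to\chi_i$ with $x_i(\cdot,k)$ locally absolutely continuous for each $k$, and of hybrid inputs $x_j:E\to\chi_j$ ($j\neq i$), $u:E\to U$, Lebesgue measurable and locally essentially bounded in $t$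 for each $k$, such that $(x,u)(0,0)\in C_i\cup D_i$; for each $k$ and almost all $t$ with $(t,k)\in E$, $(x,u)(t,k)\in C_i$ and $\dot x_i(t,k)=f_i(x(t,k),u(t,k))$; and whenever $(t,k),(t,k+1)\in E$, $(x,u)(t,k)\in D_i$ and $x_i(t,k+1)=g_i(x(t,k),u(t,k))$. It is maximal if it is not the restriction of a solution pair on a strictly larger hybrid time domain. For a hybrid signal $w$ on $E$, $\|w\|_{(t,k)}$ is the maximum of the essential supremum of $|w(s,l)|$ over the $(s,l)\in E$ with $s+l\le t+k$ and $(s,l+1)\notin E$, and of the supremum of $|w(s,l)|$ over the $(s,l)\in E$ with $s+l\le t+k$ and $(s,l+1)\in E$. *Comparison functions.* $\gamma:\mathbb R_+\to\mathbb R_+$ is of class $\mathcal K$ if it is continuous, strictly increasing and $\gamma(0)=0$, and of class $\mathcal K_\infty$ if it is also unbounded. $\beta:\mathbb R_+^2\to\mathbb R_+$ is of class $\mathcal{KL}$ if $\beta(\cdot,t)\in\mathcal K$ for each $t$ and $\beta(s,\cdot)$ is non-increasing and tends to $0$ for each $s$; $\beta:\mathbb R_+^3\to\mathbb R_+$ is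 of class $\mathcal{KLL}$ if $\beta(\cdot,\cdot,r),\beta(\cdot,r,\cdot)\in\mathcal{KL}$ for each $r\geq0$. A function $\alpha:\mathbb R_+\to\mathbb R_+$ is positive definite if $\alpha(0)=0$ and $\alpha(s)>0$ for $s>0$. *ISS.* The subsystem is input-to-state stable (ISS) if there are $\beta_i\in\mathcal{KLL}$ and $\gamma_{ij},\gamma_i\in\mathcal K_\infty\cup\{0\}$ ($j\ne i$) such that every maximal solution pair satisfies, for all $(t,k)$ in its domain, $$|x_i(t,k)|\le\max\Big\{\beta_i(|x_i(0,0)|,t,k),\ \max_{j\ne i}\gamma_{ij}(\|x_j\|_{(t,k)}),\ \gamma_i(\|u\|_{(t,k)})\Big\}.$$ *ISS-Lyapunov functions.* For locally Lipschitz $V_i:\chi_i\to\mathbb R_+$ let $\partial V_i(x_i)$ be Clarke's generalized gradient, the convex hull of all limits $\lim_p\nabla V_i(x^p)$ with $x^p\to x_i$, $V_i$ differentiable at $x^p$. Such a $V_i$ is an ISS-Lyapunov function for the subsystem if 1. there are $\psi_{i1},\psi_{i2}\in\mathcal K_\infty$ with $\psi_{i1}(|x_i|)\le V_i(x_i)\le\psi_{i2}(|x_i|)$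 for all $x_i\in\chi_i$; 2. there are locally Lipschitz, proper, positive definite functions $V_j:\chi_j\to\mathbb R_+$ ($j\ne i$), functions $\gamma_{ij},\gamma_i\in\mathcal K_\infty$ and continuous positive definite functions $\alpha_i,\lambda_i$ with $\lambda_i(s)<s$ for $s>0$, such that for all $(x,u)\in C_i$ $$V_i(x_i)\ge\max\{\max_{j\ne i}\gamma_{ij}(V_j(x_j)),\gamma_i(|u|)\}\ \Rightarrow\ \forall\zeta\in\partial V_i(x_i):\ \langle\zeta,f_i(x,u)\rangle\le-\alpha_i(V_i(x_i)),$$ and for all $(x,u)\in D_i$ $$V_i(g_i(x,u))\le\max\{\lambda_i(V_i(x_i)),\max_{j\ne i}\gamma_{ij}(V_j(x_j)),\gamma_i(|u|)\}.$$ Here "proper, positive definite" for $V_j$ means: $V_j(x_j)>0$ for $x_j\in\chi_j\setminus\{0\}$, $V_j(0)=0$ if $0\in\chi_j$, $V_j(x_j)\to\infty$ as $|x_j|\to\infty$ in $\chi_j$, and $V_j(x_j)\le\psi_j(|x_j|)$ on $\chi_j$ for some $\psi_j\in\mathcal K_\infty$ (the last condition is automatic when $\chi_j=\mathbb R^{N_j}$).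 **Proposition.** If the subsystem has a locally Lipschitz continuous ISS-Lyapunov function, then it is ISS. -/

import Mathlib

open Set Filter Topology MeasureTheory
open scoped NNReal ENNReal

/-! Comparison functions, on `ℝ≥0`. -/

/-- Class `K`: continuous, strictly increasing, zero at zero. -/
structure IsClassK (γ : ℝ≥0 → ℝ≥0) : Prop where
  continuous : Continuous γ
  strictMono : StrictMono γ
  map_zero : γ 0 = 0

/-- Class `K∞`: of class `K` and unbounded. -/
structure IsClassKInf (γ : ℝ≥0 → ℝ≥0) : Prop extends IsClassK γ where
  unbounded : ∀ B : ℝ≥0, ∃ s : ℝ≥0, B < γ s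

/-- Class `KL`: `β(·, t)` is of class `K` for each `t`, and `β(s, ·)` is non-increasing and tends
to zero for each `s`. -/
structure IsClassKL (β : ℝ≥0 → ℝ≥0 → ℝ≥0) : Prop where
  left : ∀ t, IsClassK fun s => β s t
  antitone : ∀ s, Antitone (β s)
  tendsto : ∀ s, Tendsto (β s) atTop (𝓝 0)

/-- Class `KLL`: for each `r`, both `β(·, ·, r)` and `β(·, r, ·)` are of class `KL`. -/
structure IsClassKLL (β : ℝ≥0 → ℝ≥0 → ℝ≥0 → ℝ≥0) : Prop where
  left : ∀ r, IsClassKL fun s t => β s t r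
  right : ∀ r, IsClassKL fun s t => β s r t

/-- Positive definite functions `ℝ≥0 → ℝ≥0`. -/
def IsPosDef (α : ℝ≥0 → ℝ≥0) : Prop :=
  α 0 = 0 ∧ ∀ s, 0 < s → 0 < α s

/-! Hybrid time domains and hybrid signals. A hybrid signal with domain `E` is represented by a
total function on `ℝ × ℕ` of which only the values on `E` are ever used. -/

/-- A hybrid time domain: a union of intervals `[t k, t (k+1)] × {k}` with
`0 = t 0 ≤ t 1 ≤ …`, over all `k` or over finitely many `k ≤ K`; in the finite case the last
interval may also be `[t K, T)` with `t K < T ≤ ∞`. -/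
def IsHybridTimeDomain (E : Set (ℝ × ℕ)) : Prop :=
  ∃ t : ℕ → ℝ, t 0 = 0 ∧ Monotone t ∧
    (E = {p | t p.2 ≤ p.1 ∧ p.1 ≤ t (p.2 + 1)} ∨
      (∃ K : ℕ, E = {p | p.2 ≤ K ∧ t p.2 ≤ p.1 ∧ p.1 ≤ t (p.2 + 1)}) ∨
      ∃ (K : ℕ) (T : EReal), (t K : EReal) < T ∧
        E = {p | (p.2 < K ∧ t p.2 ≤ p.1 ∧ p.1 ≤ t (p.2 + 1)) ∨
          (p.2 = K ∧ t K ≤ p.1 ∧ (p.1 : EReal) < T)})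

/-- The times `s` with `(s, k) ∈ E`. -/
def timeSlice (E : Set (ℝ × ℕ)) (k : ℕ) : Set ℝ :=
  {s | (s, k) ∈ E}

/-- The points of the hybrid time domain at which a jump occurs. -/
def jumpPoints (E : Set (ℝ × ℕ)) : Set (ℝ × ℕ) :=
  {p | p ∈ E ∧ (p.1, p.2 + 1) ∈ E}

/-- The supremum norm `‖u‖_(t,k)` of a hybrid signal `u` with domain `E`: the maximum of the
essential supremum of `|u(s,l)|` over the non-jump points `(s,l) ∈ E` with `s + l ≤ t + k` and of
the supremum of `|u(s,l)|` over the jump points `(s,l)` with `s + l ≤ t + k`. It is finite when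
`(t, k) ∈ E` and `u(·, l)` is locally essentially bounded for each `l`. -/
noncomputable def hybridNorm {F : Type*} [NormedAddCommGroup F] (E : Set (ℝ × ℕ))
    (u : ℝ × ℕ → F) (t : ℝ) (k : ℕ) : ℝ≥0∞ :=
  max
    (⨆ l : ℕ, essSup (fun s : ℝ => ‖u (s, l)‖ₑ)
      (volume.restrict {s : ℝ | (s, l) ∈ E \ jumpPoints E ∧ s + l ≤ t + k}))
    (⨆ p ∈ {p : ℝ × ℕ | p ∈ jumpPoints E ∧ p.1 + p.2 ≤ t + k}, ‖u p‖ₑ)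

/-- Hybrid inputs with values in `A`: `u(·, k)` is Lebesgue measurable and locally essentially
bounded on its interval of definition, for each `k`. -/
structure IsHybridInput {F : Type*} [NormedAddCommGroup F] [MeasurableSpace F]
    (E : Set (ℝ × ℕ)) (A : Set F) (u : ℝ × ℕ → F) : Prop where
  mem : ∀ p ∈ E, u p ∈ A
  measurable : ∀ k, AEMeasurable (fun s => u (s, k)) (volume.restrict (timeSlice E k))
  locallyBounded : ∀ k, ∀ J : Set ℝ, IsCompact J → J ⊆ timeSlice E k →
    ∃ B : ℝ, ∀ᵐ s ∂(volume.restrict J), ‖u (s, k)‖ ≤ B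

/-- Hybrid arcs with values in `A`: `x(·, k)` is locally absolutely continuous for each `k`. -/
structure IsHybridArc {F : Type*} [NormedAddCommGroup F] (E : Set (ℝ × ℕ)) (A : Set F)
    (x : ℝ × ℕ → F) : Prop where
  mem : ∀ p ∈ E, x p ∈ A
  absCont : ∀ k, ∀ a b : ℝ, a ≤ b → Icc a b ⊆ timeSlice E k →
    AbsolutelyContinuousOnInterval (fun s => x (s, k)) a b

/-! Hybrid subsystems. -/

/-- The joint space of `(x_1, …, x_n, u)`, where `x_j ∈ ℝ^(N j)` and `u ∈ ℝ^M`. -/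
abbrev HybridSpace {n : ℕ} (N : Fin n → ℕ) (M : ℕ) : Type :=
  (∀ j, EuclideanSpace ℝ (Fin (N j))) × EuclideanSpace ℝ (Fin M)

/-- The `i`-th subsystem of an interconnection of `n` hybrid subsystems,
`ẋ_i = f_i(x_1, …, x_n, u)` on `C_i` and `x_i⁺ = g_i(x_1, …, x_n, u)` on `D_i`, with state sets
`χ j ⊆ ℝ^(N j)` and input set `U ⊆ ℝ^M`. Only the values of `f` on `C` and of `g` on `D`
matter. -/
structure HybridSubsystem {n : ℕ} (N : Fin n → ℕ) (M : ℕ) (i : Fin n) where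
  χ : ∀ j, Set (EuclideanSpace ℝ (Fin (N j)))
  U : Set (EuclideanSpace ℝ (Fin M))
  C : Set (HybridSpace N M)
  D : Set (HybridSpace N M)
  f : HybridSpace N M → EuclideanSpace ℝ (Fin (N i))
  g : HybridSpace N M → EuclideanSpace ℝ (Fin (N i))
  C_subset : C ⊆ univ.pi χ ×ˢ U
  D_subset : D ⊆ univ.pi χ ×ˢ U
  g_mapsTo : MapsTo g D (χ i)

/-- Clarke's generalized gradient of `V` at `x`: the convex hull of the limits of gradients
`∇V(x_p)` along sequences `x_p → x` of points of differentiability. -/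
noncomputable def clarkeGradient {m : ℕ} (V : EuclideanSpace ℝ (Fin m) → ℝ)
    (x : EuclideanSpace ℝ (Fin m)) : Set (EuclideanSpace ℝ (Fin m)) :=
  convexHull ℝ {ζ | ∃ y : ℕ → EuclideanSpace ℝ (Fin m), Tendsto y atTop (𝓝 x) ∧
    (∀ p, DifferentiableAt ℝ V (y p)) ∧ Tendsto (fun p => gradient V (y p)) atTop (𝓝 ζ)}

/-- `V` is positive definite and proper on `A ⊆ ℝ^m`: it vanishes at most at the origin, is zero
there, tends to infinity as `|x| → ∞` in `A`, and is bounded by a function of class `K∞` of the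
norm. For continuous `V` on `A = ℝ^m` the last clause follows from the others. -/
structure IsProperPosDefOn {m : ℕ} (A : Set (EuclideanSpace ℝ (Fin m)))
    (V : EuclideanSpace ℝ (Fin m) → ℝ≥0) : Prop where
  zero : (0 : EuclideanSpace ℝ (Fin m)) ∈ A → V 0 = 0
  pos : ∀ x ∈ A, x ≠ 0 → 0 < V x
  radiallyUnbounded : ∀ c : ℝ≥0, ∃ R : ℝ≥0, ∀ x ∈ A, R < ‖x‖₊ → c < V x
  upper : ∃ ψ : ℝ≥0 → ℝ≥0, IsClassKInf ψ ∧ ∀ x ∈ A, V x ≤ ψ ‖x‖₊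

namespace HybridSubsystem

variable {n M : ℕ} {N : Fin n → ℕ} {i : Fin n}

/-- The basic regularity conditions: the `χ j` are open, `U` is closed, `C` and `D` are relatively
closed in `χ × U`, and `f`, `g` are continuous. -/
structure Regular (S : HybridSubsystem N M i) : Prop where
  isOpen_χ : ∀ j, IsOpen (S.χ j)
  isClosed_U : IsClosed S.U
  relClosed_C : S.C = closure S.C ∩ (univ.pi S.χ ×ˢ S.U)
  relClosed_D : S.D = closure S.D ∩ (univ.pi S.χ ×ˢ S.U)
  continuousOn_f : ContinuousOn S.f S.C
  continuousOn_g : ContinuousOn S.g S.D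

/-- `(x, u)` is a solution pair of the subsystem with hybrid time domain `E`: `x i` is the hybrid
arc, and the `x j` with `j ≠ i` together with `u` form the hybrid input. -/
structure IsSolutionPair (S : HybridSubsystem N M i) (E : Set (ℝ × ℕ))
    (x : ∀ j, ℝ × ℕ → EuclideanSpace ℝ (Fin (N j)))
    (u : ℝ × ℕ → EuclideanSpace ℝ (Fin M)) : Prop where
  domain : IsHybridTimeDomain E
  arc : IsHybridArc E (S.χ i) (x i)
  input_state : ∀ j, j ≠ i → IsHybridInput E (S.χ j) (x j)
  input_ext : IsHybridInput E S.U u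
  initial : ((fun j => x j (0, 0), u (0, 0)) : HybridSpace N M) ∈ S.C ∪ S.D
  flow : ∀ k, ∀ᵐ s ∂(volume.restrict (timeSlice E k)),
    ((fun j => x j (s, k), u (s, k)) : HybridSpace N M) ∈ S.C ∧
      HasDerivAt (fun r => x i (r, k)) (S.f (fun j => x j (s, k), u (s, k))) s
  jump : ∀ p ∈ jumpPoints E,
    ((fun j => x j p, u p) : HybridSpace N M) ∈ S.D ∧
      x i (p.1, p.2 + 1) = S.g (fun j => x j p, u p)

/-- A maximal solution pair: one that cannot be extended to a solution pair on a strictly larger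
hybrid time domain. -/
structure IsMaximalSolutionPair (S : HybridSubsystem N M i) (E : Set (ℝ × ℕ))
    (x : ∀ j, ℝ × ℕ → EuclideanSpace ℝ (Fin (N j)))
    (u : ℝ × ℕ → EuclideanSpace ℝ (Fin M)) : Prop extends S.IsSolutionPair E x u where
  maximal : ∀ E' x' u', S.IsSolutionPair E' x' u' → E ⊆ E' →
    (∀ p ∈ E, (∀ j, x' j p = x j p) ∧ u' p = u p) → E' = E

/-- Input-to-state stability of the subsystem. -/
def IsISS (S : HybridSubsystem N M i) : Prop :=
  ∃ (β : ℝ≥0 → ℝ≥0 → ℝ≥0 → ℝ≥0) (γ : Fin n → ℝ≥0 → ℝ≥0) (γu : ℝ≥0 → ℝ≥0),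
    IsClassKLL β ∧ (∀ j, j ≠ i → IsClassKInf (γ j) ∨ γ j = 0) ∧ (IsClassKInf γu ∨ γu = 0) ∧
    ∀ E x u, S.IsMaximalSolutionPair E x u → ∀ t k, (t, k) ∈ E →
      ‖x i (t, k)‖₊ ≤ max (β ‖x i (0, 0)‖₊ t.toNNReal k)
        (max ((Finset.univ.erase i).sup fun j => γ j (hybridNorm E (x j) t k).toNNReal)
          (γu (hybridNorm E u t k).toNNReal))

/-- Locally Lipschitz ISS-Lyapunov functions of the subsystem. -/
def IsISSLyapunov (S : HybridSubsystem N M i) (V : EuclideanSpace ℝ (Fin (N i)) → ℝ≥0) : Prop :=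
  LocallyLipschitzOn (S.χ i) V ∧
  (∃ ψ₁ ψ₂ : ℝ≥0 → ℝ≥0, IsClassKInf ψ₁ ∧ IsClassKInf ψ₂ ∧
    ∀ x ∈ S.χ i, ψ₁ ‖x‖₊ ≤ V x ∧ V x ≤ ψ₂ ‖x‖₊) ∧
  ∃ (W : ∀ j, EuclideanSpace ℝ (Fin (N j)) → ℝ≥0) (γ : Fin n → ℝ≥0 → ℝ≥0)
    (γu α lam : ℝ≥0 → ℝ≥0),
    (∀ j, j ≠ i → LocallyLipschitzOn (S.χ j) (W j) ∧ IsProperPosDefOn (S.χ j) (W j)) ∧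
    (∀ j, j ≠ i → IsClassKInf (γ j)) ∧ IsClassKInf γu ∧
    (Continuous α ∧ IsPosDef α) ∧ (Continuous lam ∧ IsPosDef lam ∧ ∀ s, 0 < s → lam s < s) ∧
    (∀ z ∈ S.C,
      max ((Finset.univ.erase i).sup fun j => γ j (W j (z.1 j))) (γu ‖z.2‖₊) ≤ V (z.1 i) →
      ∀ ζ ∈ clarkeGradient (fun y => (V y : ℝ)) (z.1 i),
        inner ℝ ζ (S.f z) ≤ -(α (V (z.1 i)) : ℝ)) ∧
    ∀ z ∈ S.D,
      V (S.g z) ≤ max (lam (V (z.1 i)))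
        (max ((Finset.univ.erase i).sup fun j => γ j (W j (z.1 j))) (γu ‖z.2‖₊))

end HybridSubsystem

/-! Fix a point `(t, k)` of the domain and let `R` be the largest of the input gains evaluated at
the norms up to `(t, k)`. If `V` is at most `R` there, the gain terms bound the state. Otherwise `V`
exceeds `R` on the whole past. Along a flow, `V` cannot climb above `R` from a value at most `R`,
because it does not increase while it is at least `R`. A jump that lands above `R` must come from
the `lam` branch, and `lam s ≤ s`, so `V` was above `R` before it too.

Hence the decrease conditions hold throughout: `V` loses rate `α` during total flow time `t`, never
rising at jumps, and loses at least `s - lam s` at each of `k` jumps, never rising along flows.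
These are two separate `KL` estimates, in `t` and in `k`; their minimum is `KLL`, and the bounds
`ψ₁`, `ψ₂` carry it from `V` to the norm (`IsJumpTimes.decayBound`, `IsClassKL.isClassKLL_min`).

No comparison equation is solved. `DecayBound` records only the loss guaranteed by lower bounds of
the rate, which composes and treats flows and jumps alike; `exists_isClassKL_of_decayBound` makes a
`KL` function of it. Since `V` is merely Lipschitz, the flow condition reaches the derivative of `V`
along the arc through `deriv_comp_le_of_clarkeGradient`. -/

/-! ### Growth of absolutely continuous functions -/

/-- An absolutely continuous function whose derivative is almost everywhere at most `C` grows at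
most at rate `C`. -/
theorem AbsolutelyContinuousOnInterval.sub_le_of_ae_deriv_le {φ : ℝ → ℝ} {a b C : ℝ}
    (hab : a ≤ b) (hφ : AbsolutelyContinuousOnInterval φ a b)
    (h : ∀ᵐ s, s ∈ Icc a b → deriv φ s ≤ C) : φ b - φ a ≤ C * (b - a) := by
  rw [← hφ.integral_deriv_eq_sub]
  calc ∫ s in a..b, deriv φ s ≤ ∫ _ in a..b, C := by
        refine intervalIntegral.integral_mono_ae_restrict hab hφ.intervalIntegrable_deriv
          intervalIntegrable_const ?_
        rwa [EventuallyLE, ae_restrict_iff' measurableSet_Icc]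
    _ = C * (b - a) := by simp [mul_comm]

/-- After the last time `c` at which `φ ≤ R`, the derivative is nonpositive almost everywhere, so `φ
b ≤ φ c ≤ R`. -/
theorem AbsolutelyContinuousOnInterval.antitone_le_of_ae_deriv_nonpos {φ : ℝ → ℝ} {a b R : ℝ}
    (hab : a ≤ b) (hφ : AbsolutelyContinuousOnInterval φ a b)
    (h : ∀ᵐ s, s ∈ Icc a b → R ≤ φ s → deriv φ s ≤ 0) (ha : φ a ≤ R) : φ b ≤ R := by
  by_contra! hb
  have hc : ContinuousOn φ (Icc a b) := by simpa [uIcc_of_le hab] using hφ.continuousOn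
  have hcomp : IsCompact (Icc a b ∩ φ ⁻¹' Iic R) :=
    isCompact_Icc.of_isClosed_subset (hc.preimage_isClosed_of_isClosed isClosed_Icc isClosed_Iic)
      inter_subset_left
  obtain ⟨c, ⟨hcI, hcR⟩, hmax⟩ := hcomp.exists_isGreatest ⟨a, ⟨le_rfl, hab⟩, ha⟩
  have hsub : Icc c b ⊆ Icc a b := Icc_subset_Icc_left hcI.1
  have key := (hφ.mono (c := c) (d := b)
    (by rwa [uIcc_of_le hab, uIcc_of_le hcI.2])).sub_le_of_ae_deriv_le (C := 0) hcI.2 (by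
      filter_upwards [h, Measure.ae_ne volume c] with s hs hne hsI
      refine hs (hsub hsI) ?_
      by_contra! hlt
      exact hne (le_antisymm (hmax ⟨hsub hsI, hlt.le⟩) hsI.1))
  have : φ c ≤ R := hcR
  linarith

/-! ### Clarke gradients and the chain rule inequality -/

section Clarke

variable {m : ℕ} {V : EuclideanSpace ℝ (Fin m) → ℝ} {x w : EuclideanSpace ℝ (Fin m)}

theorem inner_gradient_eq_fderiv (V : EuclideanSpace ℝ (Fin m) → ℝ)
    (y w : EuclideanSpace ℝ (Fin m)) : inner ℝ (gradient V y) w = fderiv ℝ V y w := by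
  simp [gradient]

/-- Otherwise gradients violating the bound exist at points tending to `x`. They are bounded by the
Lipschitz constant, so a subsequence converges, and its limit lies in the Clarke gradient and
contradicts `hc`. -/
theorem exists_ball_inner_gradient_le {K : ℝ≥0} {δ₀ c c' : ℝ} (hδ₀ : 0 < δ₀)
    (hV : LipschitzOnWith K V (Metric.ball x δ₀))
    (hc : ∀ ζ ∈ clarkeGradient V x, inner ℝ ζ w ≤ c) (hcc : c < c') :
    ∃ δ > 0, δ ≤ δ₀ ∧ ∀ y ∈ Metric.ball x δ, DifferentiableAt ℝ V y →
      inner ℝ (gradient V y) w ≤ c' := by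
  by_contra! H
  have hpos : ∀ p : ℕ, 0 < min δ₀ (1 / ((p : ℝ) + 1)) := fun p => lt_min hδ₀ (by positivity)
  choose y hyb hyd hyc using fun p : ℕ => H _ (hpos p) (min_le_left _ _)
  have hlim : Tendsto y atTop (𝓝 x) := by
    rw [tendsto_iff_dist_tendsto_zero]
    refine squeeze_zero (fun _ => dist_nonneg) (fun p => ?_)
      (tendsto_one_div_add_atTop_nhds_zero_nat (𝕜 := ℝ))
    exact (Metric.mem_ball.1 (hyb p)).le.trans (min_le_right _ _)
  have hbd : ∀ p, gradient V (y p) ∈ Metric.closedBall (0 : EuclideanSpace ℝ (Fin m)) K := by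
    intro p
    rw [mem_closedBall_zero_iff, gradient, LinearIsometryEquiv.norm_map]
    exact norm_fderiv_le_of_lipschitzOn ℝ
      (Metric.isOpen_ball.mem_nhds (Metric.ball_subset_ball (min_le_left _ _) (hyb p))) hV
  obtain ⟨ζ, -, σ, hσ, hζ⟩ := (isCompact_closedBall _ _).tendsto_subseq hbd
  have h1 : inner ℝ ζ w ≤ c := hc ζ (subset_convexHull ℝ _
    ⟨y ∘ σ, hlim.comp hσ.tendsto_atTop, fun p => hyd _, hζ⟩)
  have h2 : c' ≤ inner ℝ ζ w :=
    ge_of_tendsto (hζ.inner tendsto_const_nhds) (Eventually.of_forall fun p => (hyc (σ p)).le)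
  linarith

/-- `V` may fail to be differentiable all along the segment from `x`. By Rademacher and Fubini, for
almost every base point `y` it is differentiable almost everywhere on the parallel segment, where
the gradient bound integrates. Such `y` are dense, and continuity gives the bound at `x`. -/
theorem sub_le_of_inner_gradient_le {K : ℝ≥0} {δ c h : ℝ}
    (hV : LipschitzOnWith K V (Metric.ball x δ))
    (hc : ∀ y ∈ Metric.ball x δ, DifferentiableAt ℝ V y → inner ℝ (gradient V y) w ≤ c)
    (hh : 0 ≤ h) (hhδ : h * ‖w‖ < δ) : V (x + h • w) - V x ≤ c * h := by
  obtain ⟨G, hG, hVG⟩ := hV.extend_real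
  have hδ : 0 < δ := lt_of_le_of_lt (by positivity) hhδ
  have hae : ∀ᵐ y : EuclideanSpace ℝ (Fin m), ∀ᵐ s : ℝ, DifferentiableAt ℝ G (y + s • w) := by
    have := (ae_ae_add_linearMap_mem_iff (𝕜 := ℝ) (LinearMap.toSpanSingleton ℝ _ w)
      (volume : Measure ℝ) (volume : Measure (EuclideanSpace ℝ (Fin m)))
      (measurableSet_of_differentiableAt ℝ G)).2 hG.ae_differentiableAt
    simpa using this
  have hdense := Measure.dense_of_ae hae
  have hmem : ∀ y ∈ Metric.ball x (δ - h * ‖w‖), ∀ s ∈ Icc 0 h, y + s • w ∈ Metric.ball x δ := by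
    intro y hy s hs
    rw [Metric.mem_ball, dist_eq_norm] at *
    calc ‖y + s • w - x‖ = ‖(y - x) + s • w‖ := by congr 1; abel
      _ ≤ ‖y - x‖ + ‖s • w‖ := norm_add_le _ _
      _ ≤ ‖y - x‖ + h * ‖w‖ := by
        rw [norm_smul, Real.norm_of_nonneg hs.1]; gcongr; exact hs.2
      _ < δ := by linarith
  have key : ∀ y ∈ Metric.ball x (δ - h * ‖w‖), (∀ᵐ s : ℝ, DifferentiableAt ℝ G (y + s • w)) →
      G (y + h • w) - G y ≤ c * h := by
    intro y hy hys
    have hlip : LipschitzWith (K * ‖w‖₊) fun s : ℝ => G (y + s • w) := by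
      refine hG.comp (LipschitzWith.of_dist_le_mul fun s s' => ?_)
      rw [dist_add_left, dist_eq_norm, ← sub_smul, norm_smul, mul_comm, dist_eq_norm, coe_nnnorm]
    have := (hlip.lipschitzOnWith (s := uIcc 0 h)).absolutelyContinuousOnInterval
      |>.sub_le_of_ae_deriv_le (C := c) hh (by
        filter_upwards [hys] with s hs hsI
        have hb := hmem y hy s hsI
        have heq : V =ᶠ[𝓝 (y + s • w)] G :=
          hVG.eventuallyEq_of_mem (Metric.isOpen_ball.mem_nhds hb)
        have hd : HasDerivAt (fun s : ℝ => y + s • w) w s := by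
          simpa using ((hasDerivAt_id s).smul_const w).const_add y
        have hd2 := hs.hasFDerivAt.comp_hasDerivAt s hd
        have := hc _ hb (heq.differentiableAt_iff.2 hs)
        rw [inner_gradient_eq_fderiv, heq.fderiv_eq] at this
        rw [show deriv (fun s : ℝ => G (y + s • w)) s = _ from hd2.deriv]
        exact this)
    simpa using this
  have hxb : x ∈ Metric.ball x (δ - h * ‖w‖) := Metric.mem_ball_self (by linarith)
  have h0 : V x = G x := hVG (Metric.mem_ball_self hδ)
  have h1 : V (x + h • w) = G (x + h • w) := hVG (hmem x hxb h ⟨hh, le_rfl⟩)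
  rw [h0, h1]
  by_contra! hlt
  have hopen : IsOpen {y | c * h < G (y + h • w) - G y} := by
    have := hG.continuous
    exact isOpen_lt continuous_const (by fun_prop)
  obtain ⟨y, ⟨hy1, hy2⟩, hy3⟩ := hdense.inter_open_nonempty _ (hopen.inter Metric.isOpen_ball)
    ⟨x, hlt, hxb⟩
  exact absurd (key y hy2 hy3) (not_le.2 hy1)

/-- Chain rule inequality for Clarke's generalized gradient along a differentiable curve. -/
theorem deriv_comp_le_of_clarkeGradient {A : Set (EuclideanSpace ℝ (Fin m))} {c s : ℝ}
    {z : ℝ → EuclideanSpace ℝ (Fin m)} (hA : IsOpen A) (hV : LocallyLipschitzOn A V)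
    (hz : HasDerivAt z w s) (hzA : z s ∈ A)
    (hd : DifferentiableAt ℝ (fun r => V (z r)) s)
    (hc : ∀ ζ ∈ clarkeGradient V (z s), inner ℝ ζ w ≤ c) :
    deriv (fun r => V (z r)) s ≤ c := by
  refine le_of_forall_gt_imp_ge_of_dense fun c' hcc => ?_
  obtain ⟨K, T, hT, hKT⟩ := hV hzA
  rw [hA.nhdsWithin_eq hzA] at hT
  obtain ⟨δ₀, hδ₀, hbT⟩ := Metric.mem_nhds_iff.1 hT
  obtain ⟨δ, hδ, hδδ, hg⟩ := exists_ball_inner_gradient_le hδ₀ (hKT.mono hbT) hc hcc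
  have hVδ : LipschitzOnWith K V (Metric.ball (z s) δ) :=
    hKT.mono ((Metric.ball_subset_ball hδδ).trans hbT)
  have hle : (𝓝[>] (0 : ℝ)) ≤ 𝓝[≠] 0 := nhdsWithin_mono _ fun _ h => ne_of_gt h
  have t1 := (hasDerivAt_iff_tendsto_slope_zero.1 hd.hasDerivAt).mono_left hle
  -- This majorizes the difference quotient of `V` along `z`: `c'` for the tangent line, plus the
  -- Lipschitz cost of replacing `z (s + h)` by `z s + h • w`.
  have t2 : Tendsto (fun h : ℝ => c' + K * ‖h⁻¹ • (z (s + h) - z s) - w‖) (𝓝[>] 0) (𝓝 c') := by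
    have := (((hasDerivAt_iff_tendsto_slope_zero.1 hz).mono_left hle).sub_const w).norm.const_mul
      (K : ℝ) |>.const_add c'
    simpa using this
  refine le_of_tendsto_of_tendsto t1 t2 ?_
  have e1 : ∀ᶠ h : ℝ in 𝓝[>] 0, z (s + h) ∈ Metric.ball (z s) δ := by
    have : Tendsto (fun h : ℝ => z (s + h)) (𝓝 0) (𝓝 (z s)) := by
      have h0 : Tendsto (fun h : ℝ => s + h) (𝓝 0) (𝓝 s) := by
        simpa using (tendsto_id (α := ℝ) (x := 𝓝 0)).const_add s
      exact hz.continuousAt.tendsto.comp h0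
    exact (this.mono_left nhdsWithin_le_nhds) (Metric.ball_mem_nhds _ hδ)
  have e2 : ∀ᶠ h : ℝ in 𝓝[>] 0, h * ‖w‖ < δ := by
    have : Tendsto (fun h : ℝ => h * ‖w‖) (𝓝 0) (𝓝 0) := by
      simpa using (tendsto_id (α := ℝ) (x := 𝓝 0)).mul_const ‖w‖
    exact (this.mono_left nhdsWithin_le_nhds).eventually (gt_mem_nhds hδ)
  filter_upwards [e1, e2, self_mem_nhdsWithin] with h h1 h2 h3
  have h3 : 0 < h := h3
  have hs := sub_le_of_inner_gradient_le hVδ hg h3.le h2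
  have hb : z s + h • w ∈ Metric.ball (z s) δ := by
    simpa [norm_smul, abs_of_pos h3] using h2
  have hl := (le_abs_self _).trans (hVδ.dist_le_mul _ h1 _ hb)
  have hn : dist (z (s + h)) (z s + h • w) = h * ‖h⁻¹ • (z (s + h) - z s) - w‖ := by
    rw [dist_eq_norm, ← Real.norm_of_nonneg h3.le, ← norm_smul, Real.norm_of_nonneg h3.le,
      smul_sub, smul_smul, mul_inv_cancel₀ h3.ne', one_smul]
    congr 1; abel
  rw [hn] at hl
  rw [smul_eq_mul, inv_mul_le_iff₀ h3]
  nlinarith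

end Clarke

/-! ### Comparison functions -/

theorem IsClassKInf.surjective {γ : ℝ≥0 → ℝ≥0} (h : IsClassKInf γ) : Function.Surjective γ := by
  intro y
  obtain ⟨s, hs⟩ := h.unbounded y
  exact mem_range_of_exists_le_of_exists_ge h.continuous ⟨0, by simp [h.map_zero]⟩ ⟨s, hs.le⟩

theorem IsClassKInf.exists_inverse {γ : ℝ≥0 → ℝ≥0} (h : IsClassKInf γ) :
    ∃ φ, IsClassKInf φ ∧ ∀ s, φ (γ s) = s := by
  let e := h.strictMono.orderIsoOfSurjective γ h.surjective
  have he : ∀ s, e.symm (γ s) = s := fun s => e.symm_apply_apply s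
  refine ⟨e.symm, ⟨⟨e.symm.continuous, e.symm.strictMono, ?_⟩, fun B => ⟨γ (B + 1), ?_⟩⟩, he⟩
  · simpa [h.map_zero] using he 0
  · rw [he]; exact lt_add_one B

theorem IsClassK.comp {γ δ : ℝ≥0 → ℝ≥0} (hγ : IsClassK γ) (hδ : IsClassK δ) :
    IsClassK (γ ∘ δ) :=
  ⟨hγ.continuous.comp hδ.continuous, hγ.strictMono.comp hδ.strictMono, by
    simp [hγ.map_zero, hδ.map_zero]⟩

theorem IsClassKInf.comp {γ δ : ℝ≥0 → ℝ≥0} (hγ : IsClassKInf γ) (hδ : IsClassKInf δ) :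
    IsClassKInf (γ ∘ δ) := by
  refine ⟨hγ.toIsClassK.comp hδ.toIsClassK, fun B => ?_⟩
  obtain ⟨s, hs⟩ := hγ.unbounded B
  obtain ⟨r, hr⟩ := hδ.unbounded s
  exact ⟨r, hs.trans (hγ.strictMono hr)⟩

theorem IsClassK.min {γ δ : ℝ≥0 → ℝ≥0} (hγ : IsClassK γ) (hδ : IsClassK δ) :
    IsClassK fun s => min (γ s) (δ s) :=
  ⟨hγ.continuous.min hδ.continuous, fun _ _ h => min_lt_min (hγ.strictMono h) (hδ.strictMono h), by
    simp [hγ.map_zero]⟩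

/-- The minimum of two `KL` bounds, in two different time variables, is a `KLL` bound. -/
theorem IsClassKL.isClassKLL_min {β₁ β₂ : ℝ≥0 → ℝ≥0 → ℝ≥0} {φ ψ : ℝ≥0 → ℝ≥0}
    (h₁ : IsClassKL β₁) (h₂ : IsClassKL β₂) (hφ : IsClassK φ) (hψ : IsClassK ψ) :
    IsClassKLL fun s t r => φ (min (β₁ (ψ s) t) (β₂ (ψ s) r)) := by
  have hK : ∀ t r, IsClassK fun s => φ (min (β₁ (ψ s) t) (β₂ (ψ s) r)) := fun t r =>
    hφ.comp (((h₁.left t).comp hψ).min ((h₂.left r).comp hψ))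
  have hφ0 : Tendsto φ (𝓝 0) (𝓝 0) := by
    simpa [hφ.map_zero] using hφ.continuous.tendsto 0
  refine ⟨fun r => ⟨fun t => hK t r, fun s t t' h => ?_, fun s => ?_⟩,
    fun t => ⟨fun r => hK t r, fun s r r' h => ?_, fun s => ?_⟩⟩
  · exact hφ.strictMono.monotone (min_le_min_right _ (h₁.antitone _ h))
  · refine hφ0.comp ?_
    simpa using (h₁.tendsto (ψ s)).min (tendsto_const_nhds (x := β₂ (ψ s) r))
  · exact hφ.strictMono.monotone (min_le_min_left _ (h₂.antitone _ h))
  · refine hφ0.comp ?_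
    simpa using (tendsto_const_nhds (x := β₁ (ψ s) t)).min (h₂.tendsto (ψ s))

/-! ### Decay bounds and the `KL` functions they generate -/

/-- The value `a` can be reached from `r` in time `t` by decreasing at rate at least `α`: the
decrease is at least `t * m` for every lower bound `m` of `α` on `[a, r]`. -/
def DecayBound (α : ℝ≥0 → ℝ≥0) (a r t : ℝ≥0) : Prop :=
  a ≤ r ∧ ∀ m, (∀ s ∈ Icc a r, m ≤ α s) → a + t * m ≤ r

namespace DecayBound

variable {α : ℝ≥0 → ℝ≥0} {a b r t t' : ℝ≥0}

theorem of_le (h : a ≤ r) : DecayBound α a r 0 := ⟨h, fun m _ => by simpa using h⟩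

theorem trans (h : DecayBound α a b t) (h' : DecayBound α b r t') :
    DecayBound α a r (t + t') := by
  refine ⟨h.1.trans h'.1, fun m hm => ?_⟩
  have h1 := h.2 m fun s hs => hm s ⟨hs.1, hs.2.trans h'.1⟩
  have h2 := h'.2 m fun s hs => hm s ⟨h.1.trans hs.1, hs.2⟩
  calc a + (t + t') * m = (a + t * m) + t' * m := by ring
    _ ≤ b + t' * m := by gcongr
    _ ≤ r := h2

theorem anti (h : DecayBound α a r t') (htt : t ≤ t') : DecayBound α a r t :=
  ⟨h.1, fun m hm => le_trans (by gcongr) (h.2 m hm)⟩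

end DecayBound

/-- The Lipschitz regularization, in the initial value, of the largest value allowed by
`DecayBound`. -/
noncomputable def decaySup (α : ℝ≥0 → ℝ≥0) (r t : ℝ≥0) : ℝ≥0 :=
  sSup {c | ∃ a s, DecayBound α a s t ∧ c = a - 2 * (s - r)}

section decaySup

variable {α : ℝ≥0 → ℝ≥0}

theorem sub_le_of_decayBound {a r s t : ℝ≥0} (h : DecayBound α a s t) :
    a - 2 * (s - r) ≤ r := by
  rw [tsub_le_iff_left]
  have h1 : s ≤ s - r + r := le_tsub_add
  calc a ≤ s - r + r := h.1.trans h1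
    _ ≤ 2 * (s - r) + r := by gcongr; exact le_mul_of_one_le_left' one_le_two

theorem le_decaySup {a r s t : ℝ≥0} (h : DecayBound α a s t) :
    a - 2 * (s - r) ≤ decaySup α r t := by
  refine le_csSup ⟨r, ?_⟩ ⟨a, s, h, rfl⟩
  rintro c ⟨a, s, h, rfl⟩
  exact sub_le_of_decayBound h

theorem decaySup_le {r t B : ℝ≥0}
    (h : ∀ a s, DecayBound α a s t → a - 2 * (s - r) ≤ B) : decaySup α r t ≤ B := by
  refine csSup_le' ?_
  rintro c ⟨a, s, h', rfl⟩
  exact h a s h'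

theorem decaySup_mono (t : ℝ≥0) : Monotone fun r => decaySup α r t := fun r r' hr =>
  decaySup_le fun _ _ h => le_trans (by gcongr) (le_decaySup h)

theorem decaySup_antitone (r : ℝ≥0) : Antitone (decaySup α r) := fun _ _ ht =>
  decaySup_le fun _ _ h => le_decaySup (h.anti ht)

theorem decaySup_zero (t : ℝ≥0) : decaySup α 0 t = 0 :=
  le_antisymm (decaySup_le fun _ _ h => sub_le_of_decayBound h) zero_le

theorem decaySup_le_add (r r' t : ℝ≥0) :
    decaySup α r' t ≤ decaySup α r t + 2 * (r' - r) := by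
  refine decaySup_le fun a s h => ?_
  rw [tsub_le_iff_left]
  have h1 : a ≤ decaySup α r t + 2 * (s - r) := tsub_le_iff_right.1 (le_decaySup h)
  have h2 : s - r ≤ (s - r') + (r' - r) := tsub_le_tsub_add_tsub
  calc a ≤ decaySup α r t + 2 * ((s - r') + (r' - r)) := h1.trans (by gcongr)
    _ = _ := by ring

theorem continuous_decaySup (t : ℝ≥0) : Continuous fun r => decaySup α r t := by
  have : LipschitzWith 2 fun r => (decaySup α r t : ℝ) := by
    refine LipschitzWith.of_le_add_mul _ fun r' r => ?_
    have h := NNReal.coe_le_coe.2 (decaySup_le_add (α := α) r r' t)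
    push_cast at h
    have h2 : ((r' - r : ℝ≥0) : ℝ) ≤ dist r' r := by
      rw [NNReal.coe_sub_def, NNReal.dist_eq]
      exact max_le (le_abs_self _) (abs_nonneg _)
    refine h.trans ?_
    push_cast
    gcongr
  exact NNReal.isEmbedding_coe.continuous_iff.2 this.continuous

/-- A value above `ε'` keeps the whole range of decrease inside `[ε', 2 * r]`, where `α` has a
positive minimum, so the elapsed time is bounded. -/
theorem tendsto_decaySup (hα : Continuous α) (hp : IsPosDef α) (r : ℝ≥0) :
    Tendsto (decaySup α r) atTop (𝓝 0) := by
  rw [tendsto_order]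
  refine ⟨fun a ha => absurd ha not_lt_zero, fun ε hε => ?_⟩
  obtain ⟨ε', hε', hεε⟩ := exists_between hε
  obtain ⟨m, hm, hmα⟩ : ∃ m, 0 < m ∧ ∀ s ∈ Icc ε' (2 * r), m ≤ α s := by
    rcases (Icc ε' (2 * r)).eq_empty_or_nonempty with he | hne
    · exact ⟨1, one_pos, by simp [he]⟩
    · obtain ⟨s₀, hs₀, hmin⟩ := isCompact_Icc.exists_isMinOn hne hα.continuousOn
      exact ⟨α s₀, hp.2 _ (hε'.trans_le hs₀.1), fun s hs => hmin hs⟩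
  filter_upwards [eventually_gt_atTop (2 * r / m)] with t ht
  refine lt_of_le_of_lt (decaySup_le fun a s h => ?_) hεε
  by_contra! hlt
  have ha : ε' < a := hlt.trans_le tsub_le_self
  -- The penalty slope 2 matters here: `2 * (s - r) < a ≤ s` bounds `s`. Slope 1 would leave `s`
  -- unbounded, and `α` may vanish at infinity.
  have hs : s ≤ 2 * r := by
    have h1 : 2 * (s - r) < a := tsub_pos_iff_lt.1 (hε'.trans hlt)
    by_contra! hs
    have hrs : r ≤ s := le_trans (le_mul_of_one_le_left' one_le_two) hs.le
    have h2 := h1.trans_le h.1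
    rw [← NNReal.coe_lt_coe] at h2 hs
    push_cast [NNReal.coe_sub hrs] at h2 hs
    linarith
  have h3 := h.2 m fun q hq => hmα q ⟨ha.le.trans hq.1, hq.2.trans hs⟩
  have h4 : t * m ≤ 2 * r := (le_add_self.trans h3).trans hs
  rw [div_lt_iff₀ hm] at ht
  exact absurd h4 (not_le.2 ht)

end decaySup

/-- `decaySup` is continuous and monotone in `r`, but perhaps not strictly; the term `r / (1 + t)`
supplies strictness and still tends to zero. -/
theorem exists_isClassKL_of_decayBound {α : ℝ≥0 → ℝ≥0} (hα : Continuous α) (hp : IsPosDef α) :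
    ∃ β, IsClassKL β ∧ ∀ a r t, DecayBound α a r t → a ≤ β r t := by
  refine ⟨fun r t => decaySup α r t + r / (1 + t), ⟨fun t => ⟨?_, ?_, ?_⟩, fun r t t' h => ?_,
    fun r => ?_⟩, fun a r t h => ?_⟩
  · exact (continuous_decaySup t).add (continuous_id.div_const _)
  · refine (decaySup_mono t).add_strictMono fun r r' h => ?_
    have : (0 : ℝ≥0) < 1 + t := by positivity
    exact div_lt_div_of_pos_right h this
  · simp [decaySup_zero]
  · exact add_le_add (decaySup_antitone r h) (by gcongr)
  · have h1 : Tendsto (fun t : ℝ≥0 => r / (1 + t)) atTop (𝓝 0) := by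
      rw [← NNReal.tendsto_coe]
      push_cast
      exact tendsto_const_nhds.div_atTop
        (tendsto_atTop_add_const_left _ _ (NNReal.tendsto_coe_atTop.2 tendsto_id))
    simpa using (tendsto_decaySup hα hp r).add h1
  · refine le_trans ?_ le_self_add
    simpa using le_decaySup (r := r) h

/-! ### Decrease along flows and jumps -/

theorem LipschitzOnWith.comp_absolutelyContinuousOnInterval {X Y : Type*} [PseudoMetricSpace X]
    [PseudoMetricSpace Y] {F : X → Y} {K : ℝ≥0} {z : ℝ → X} {a b : ℝ}
    (hF : LipschitzOnWith K F (z '' uIcc a b)) (hz : AbsolutelyContinuousOnInterval z a b) :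
    AbsolutelyContinuousOnInterval (fun s => F (z s)) a b := by
  have hK : Tendsto (fun E : ℕ × (ℕ → ℝ × ℝ) =>
      (K : ℝ) * ∑ i ∈ Finset.range E.1, dist (z (E.2 i).1) (z (E.2 i).2))
      (AbsolutelyContinuousOnInterval.totalLengthFilter ⊓
        𝓟 (AbsolutelyContinuousOnInterval.disjWithin a b)) (𝓝 0) := by
    simpa using Tendsto.const_mul (K : ℝ) hz
  refine squeeze_zero' (Eventually.of_forall fun E => Finset.sum_nonneg fun _ _ => dist_nonneg)
    ?_ hK
  filter_upwards [mem_inf_of_right (mem_principal_self _)] with E hE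
  rw [Finset.mul_sum]
  exact Finset.sum_le_sum fun i hi => hF.dist_le_mul _ (mem_image_of_mem z (hE.1 i hi).1) _
    (mem_image_of_mem z (hE.1 i hi).2)

theorem LocallyLipschitzOn.comp_absolutelyContinuousOnInterval {X Y : Type*} [SeminormedAddCommGroup X]
    [PseudoMetricSpace Y] {F : X → Y} {A : Set X} {z : ℝ → X} {a b : ℝ}
    (hF : LocallyLipschitzOn A F) (hz : AbsolutelyContinuousOnInterval z a b)
    (hA : MapsTo z (uIcc a b) A) :
    AbsolutelyContinuousOnInterval (fun s => F (z s)) a b := by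
  have hc : IsCompact (z '' uIcc a b) := isCompact_uIcc.image_of_continuousOn hz.continuousOn
  have hL : LocallyLipschitzOn (z '' uIcc a b) F := hF.mono hA.image_subset
  obtain ⟨K, hK⟩ := hL.exists_lipschitzOnWith_of_compact hc
  exact hK.comp_absolutelyContinuousOnInterval hz

/-- Decrease along a flow: `v` decreases at rate at least `α` while it is at least `R`. -/
theorem DecayBound.of_flow {α : ℝ≥0 → ℝ≥0} {v : ℝ → ℝ≥0} {a b : ℝ} {R : ℝ≥0} (hab : a ≤ b)
    (hv : AbsolutelyContinuousOnInterval (fun s => (v s : ℝ)) a b)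
    (h : ∀ᵐ s, s ∈ Icc a b → R ≤ v s → deriv (fun s => (v s : ℝ)) s ≤ -(α (v s) : ℝ))
    (hR : R < v b) : R < v a ∧ DecayBound α (v b) (v a) (b - a).toNNReal := by
  have hmono : ∀ c d, a ≤ c → c ≤ d → d ≤ b →
      AbsolutelyContinuousOnInterval (fun s => (v s : ℝ)) c d := fun c d h1 h2 h3 =>
    hv.mono (by rw [uIcc_of_le hab, uIcc_of_le h2]; exact Icc_subset_Icc h1 h3)
  -- Once at most `R`, `v` would stay so until `b`, against `hR`.
  have hgt : ∀ s ∈ Icc a b, R < v s := by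
    intro s hs
    by_contra! hle
    have := (hmono s b hs.1 hs.2 le_rfl).antitone_le_of_ae_deriv_nonpos (R := R) hs.2 (by
      filter_upwards [h] with r hr hrI hrR
      refine (hr ⟨hs.1.trans hrI.1, hrI.2⟩ (NNReal.coe_le_coe.1 hrR)).trans ?_
      simp) (NNReal.coe_le_coe.2 hle)
    exact absurd (NNReal.coe_le_coe.1 this) (not_le.2 hR)
  have hanti : ∀ c d, a ≤ c → c ≤ d → d ≤ b → v d ≤ v c := by
    intro c d h1 h2 h3
    have := (hmono c d h1 h2 h3).sub_le_of_ae_deriv_le (C := 0) h2 (by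
      filter_upwards [h] with r hr hrI
      have hrI' : r ∈ Icc a b := ⟨h1.trans hrI.1, hrI.2.trans h3⟩
      refine (hr hrI' (hgt r hrI').le).trans ?_
      simp)
    rw [← NNReal.coe_le_coe]
    linarith
  refine ⟨hgt a ⟨le_rfl, hab⟩, hanti a b le_rfl hab le_rfl, fun m hm => ?_⟩
  have := hv.sub_le_of_ae_deriv_le (C := -m) hab (by
    filter_upwards [h] with r hr hrI
    refine (hr hrI (hgt r hrI).le).trans (neg_le_neg (NNReal.coe_le_coe.2 (hm _ ⟨?_, ?_⟩)))
    · exact hanti r b hrI.1 hrI.2 le_rfl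
    · exact hanti a r le_rfl hrI.1 hrI.2)
  rw [← NNReal.coe_le_coe]
  push_cast
  rw [Real.coe_toNNReal _ (sub_nonneg.2 hab)]
  linarith

/-- Decrease along a jump. -/
theorem DecayBound.of_jump {lam : ℝ≥0 → ℝ≥0} {a r : ℝ≥0} (hlam : lam r ≤ r) (h : a ≤ lam r) :
    DecayBound (fun s => s - lam s) a r 1 := by
  refine ⟨h.trans hlam, fun m hm => ?_⟩
  have := hm r ⟨h.trans hlam, le_rfl⟩
  calc a + 1 * m ≤ lam r + (r - lam r) := by rw [one_mul]; gcongr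
    _ = r := add_tsub_cancel_of_le hlam

/-! ### Jump times and hybrid norms -/

/-- `a 0 ≤ a 1 ≤ … ≤ a (k + 1)` are the jump times of the hybrid time domain `E` up to the point
`(t, k)`, preceded by `0` and followed by `t`. -/
structure IsJumpTimes (E : Set (ℝ × ℕ)) (t : ℝ) (k : ℕ) (a : ℕ → ℝ) : Prop where
  zero : a 0 = 0
  last : a (k + 1) = t
  le : ∀ l ≤ k, a l ≤ a (l + 1)
  subset : ∀ l ≤ k, Icc (a l) (a (l + 1)) ⊆ timeSlice E l
  left_le : ∀ s l, (s, l) ∈ E → l ≤ k + 1 → a l ≤ s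
  le_right : ∀ s l, (s, l) ∈ E → l < k → s ≤ a (l + 1)
  last_le : ∀ s l, (s, l) ∈ E → k < l → t ≤ s

theorem IsHybridTimeDomain.exists_isJumpTimes {E : Set (ℝ × ℕ)} (hE : IsHybridTimeDomain E)
    {t : ℝ} {k : ℕ} (h : (t, k) ∈ E) : ∃ a, IsJumpTimes E t k a := by
  obtain ⟨τ, h0, hτ, hE⟩ := hE
  have h1 : ∀ s l, (s, l) ∈ E → τ l ≤ s := by
    intro s l hs
    rcases hE with rfl | ⟨K, rfl⟩ | ⟨K, T, -, rfl⟩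
    · exact hs.1
    · exact hs.2.1
    · rcases hs with hs | hs
      · exact hs.2.1
      · obtain ⟨rfl, hs, -⟩ : l = K ∧ τ K ≤ s ∧ _ := hs
        exact hs
  have h2 : ∀ s l r l', (s, l) ∈ E → (r, l') ∈ E → l < l' → s ≤ τ (l + 1) := by
    intro s l r l' hs hr hl
    rcases hE with rfl | ⟨K, rfl⟩ | ⟨K, T, -, rfl⟩
    · exact hs.2
    · exact hs.2.2
    · rcases hs with hs | hs
      · exact hs.2.2
      · have e : l = K := hs.1
        rcases hr with hr | hr
        · have : l' < K := hr.1
          omega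
        · have : l' = K := hr.1
          omega
  have h3 : ∀ l s, l < k → τ l ≤ s → s ≤ τ (l + 1) → (s, l) ∈ E := by
    intro l s hl hs hs'
    rcases hE with rfl | ⟨K, rfl⟩ | ⟨K, T, -, rfl⟩
    · exact ⟨hs, hs'⟩
    · exact ⟨hl.le.trans h.1, hs, hs'⟩
    · refine Or.inl ⟨?_, hs, hs'⟩
      rcases h with h | h
      · exact hl.trans h.1
      · exact hl.trans_eq h.1
  have h4 : ∀ s, τ k ≤ s → s ≤ t → (s, k) ∈ E := by
    intro s hs hs'
    rcases hE with rfl | ⟨K, rfl⟩ | ⟨K, T, -, rfl⟩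
    · exact ⟨hs, hs'.trans h.2⟩
    · exact ⟨h.1, hs, hs'.trans h.2.2⟩
    · rcases h with h | h
      · exact Or.inl ⟨h.1, hs, hs'.trans h.2.2⟩
      · obtain ⟨rfl, -, hT⟩ : k = K ∧ _ ∧ (t : EReal) < T := h
        exact Or.inr ⟨rfl, hs, lt_of_le_of_lt (EReal.coe_le_coe_iff.2 hs') hT⟩
  have h5 : ∀ s l, (s, l) ∈ E → k < l → t ≤ s := fun s l hs hl =>
    (h2 t k s l h hs hl).trans ((hτ hl).trans (h1 s l hs))
  -- The interval of flow containing `(t, k)` is cut off at `t`, which makes the three kinds of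
  -- domain look the same.
  refine ⟨fun l => if l ≤ k then τ l else t, by simpa using h0, by simp, fun l hl => ?_,
    fun l hl => ?_, fun s l hs _ => ?_, fun s l hs hl => ?_, h5⟩
  · rw [if_pos hl]
    split_ifs
    · exact hτ (Nat.le_succ l)
    · obtain rfl : l = k := by omega
      exact h1 _ _ h
  · rw [if_pos hl]
    rintro s ⟨hs, hs'⟩
    split_ifs at hs'
    · exact h3 l s (by omega) hs hs'
    · obtain rfl : l = k := by omega
      exact h4 s hs hs'
  · split_ifs with hl
    · exact h1 _ _ hs
    · exact h5 s l hs (by omega)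
  · rw [if_pos (by omega)]
    exact h2 s l t k hs h hl

namespace IsJumpTimes

variable {E : Set (ℝ × ℕ)} {t : ℝ} {k : ℕ} {a : ℕ → ℝ}

theorem nonneg (ha : IsJumpTimes E t k a) {l : ℕ} (hl : l ≤ k + 1) : 0 ≤ a l := by
  induction l with
  | zero => exact ha.zero.ge
  | succ l ih => exact (ih (by omega)).trans (ha.le l (by omega))

theorem right_le_last (ha : IsJumpTimes E t k a) {l : ℕ} (hl : l ≤ k) : a (l + 1) ≤ t := by
  induction hl using Nat.decreasingInduction with
  | self => exact ha.last.le
  | of_succ l hl ih => exact (ha.le (l + 1) (by omega)).trans ih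

theorem mem_Icc_of_add_le (ha : IsJumpTimes E t k a) {s : ℝ} {l : ℕ} (hs : (s, l) ∈ E)
    (h : s + l ≤ t + k) : l ≤ k ∧ s ∈ Icc (a l) (a (l + 1)) := by
  have hl : l ≤ k := by
    by_contra! hl
    have h1 := ha.last_le s l hs hl
    have h2 : (k : ℝ) < l := by exact_mod_cast hl
    linarith
  refine ⟨hl, ha.left_le s l hs (by omega), ?_⟩
  rcases hl.lt_or_eq with hlt | rfl
  · exact ha.le_right s l hs hlt
  · rw [ha.last]; linarith

theorem add_le (ha : IsJumpTimes E t k a) {s : ℝ} {l : ℕ} (hl : l ≤ k) (hs : s ≤ a (l + 1)) :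
    s + l ≤ t + k :=
  add_le_add (hs.trans (ha.right_le_last hl)) (by exact_mod_cast hl)

theorem mem_jumpPoints (ha : IsJumpTimes E t k a) {l : ℕ} (hl : l < k) :
    (a (l + 1), l) ∈ jumpPoints E :=
  ⟨ha.subset l hl.le ⟨ha.le l hl.le, le_rfl⟩, ha.subset (l + 1) hl ⟨le_rfl, ha.le _ hl⟩⟩

variable {F : Type*} [NormedAddCommGroup F] {u : ℝ × ℕ → F}

theorem enorm_le_hybridNorm_of_jump (ha : IsJumpTimes E t k a) {l : ℕ} (hl : l < k) :
    ‖u (a (l + 1), l)‖ₑ ≤ hybridNorm E u t k :=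
  le_trans (le_iSup₂ (f := fun (p : ℝ × ℕ)
    (_ : p ∈ {p : ℝ × ℕ | p ∈ jumpPoints E ∧ p.1 + p.2 ≤ t + k}) => ‖u p‖ₑ)
    (a (l + 1), l) ⟨ha.mem_jumpPoints hl, ha.add_le hl.le le_rfl⟩) (le_max_right _ _)

/-- Interior points of an interval of flow are not jump points, so the essential supremum controls
them; the endpoints are null. -/
theorem ae_enorm_le_hybridNorm (ha : IsJumpTimes E t k a) {l : ℕ} (hl : l ≤ k) :
    ∀ᵐ s, s ∈ Icc (a l) (a (l + 1)) → ‖u (s, l)‖ₑ ≤ hybridNorm E u t k := by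
  have hsub : Ioo (a l) (a (l + 1)) ⊆ {s : ℝ | (s, l) ∈ E \ jumpPoints E ∧ s + l ≤ t + k} := by
    intro s hs
    refine ⟨⟨ha.subset l hl (Ioo_subset_Icc_self hs), fun hj => ?_⟩, ha.add_le hl hs.2.le⟩
    exact absurd (ha.left_le s (l + 1) hj.2 (by omega)) (not_le.2 hs.2)
  have h1 := ae_restrict_of_ae_restrict_of_subset (μ := volume) hsub
    (ENNReal.ae_le_essSup fun s : ℝ => ‖u (s, l)‖ₑ)
  rw [ae_restrict_iff' measurableSet_Ioo] at h1
  filter_upwards [h1, Measure.ae_ne volume (a l), Measure.ae_ne volume (a (l + 1))]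
    with s hs hn hn' hsI
  refine (hs ⟨lt_of_le_of_ne hsI.1 hn.symm, lt_of_le_of_ne hsI.2 hn'⟩).trans ?_
  exact le_trans (le_iSup (fun l : ℕ => essSup (fun s : ℝ => ‖u (s, l)‖ₑ)
    (volume.restrict {s : ℝ | (s, l) ∈ E \ jumpPoints E ∧ s + l ≤ t + k})) l) (le_max_left _ _)

/-- Only the slices `l ≤ k` contribute, each through a compact interval and at most one jump point.
Finiteness is needed because `ENNReal.toNNReal` sends `⊤` to 0. -/
theorem hybridNorm_ne_top [MeasurableSpace F] (ha : IsJumpTimes E t k a) {A : Set F}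
    (hu : IsHybridInput E A u) : hybridNorm E u t k ≠ ⊤ := by
  refine (max_lt ?_ ?_).ne
  · have hB : ∀ l, ∃ B : ℝ, l ≤ k →
        ∀ᵐ s ∂(volume.restrict (Icc (a l) (a (l + 1)))), ‖u (s, l)‖ ≤ B := by
      intro l
      by_cases hl : l ≤ k
      · obtain ⟨B, hB⟩ := hu.locallyBounded l _ isCompact_Icc (ha.subset l hl)
        exact ⟨B, fun _ => hB⟩
      · exact ⟨0, fun h => absurd h hl⟩
    choose B hB using hB
    refine lt_of_le_of_lt (iSup_le fun l => ?_)
      (ENNReal.sum_lt_top.2 fun l (_ : l ∈ Finset.range (k + 1)) => ENNReal.ofReal_lt_top (r := B l))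
    have hsub : {s : ℝ | (s, l) ∈ E \ jumpPoints E ∧ s + l ≤ t + k} ⊆ Icc (a l) (a (l + 1)) :=
      fun s hs => (ha.mem_Icc_of_add_le hs.1.1 hs.2).2
    by_cases hl : l ≤ k
    · refine le_trans (essSup_le_of_ae_le (ENNReal.ofReal (B l)) ?_)
        (Finset.single_le_sum (f := fun l => ENNReal.ofReal (B l)) (fun _ _ => zero_le)
          (Finset.mem_range.2 (Nat.lt_succ_of_le hl)))
      filter_upwards [ae_restrict_of_ae_restrict_of_subset hsub (hB l hl)] with s hs
      rw [← ofReal_norm]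
      exact ENNReal.ofReal_le_ofReal hs
    · have : {s : ℝ | (s, l) ∈ E \ jumpPoints E ∧ s + l ≤ t + k} = ∅ :=
        eq_empty_of_forall_notMem fun s hs => hl (ha.mem_Icc_of_add_le hs.1.1 hs.2).1
      rw [this]
      simp
  · refine lt_of_le_of_lt (iSup₂_le fun p hp => ?_)
      (ENNReal.sum_lt_top.2 fun l (_ : l ∈ Finset.range (k + 1)) =>
        (enorm_lt_top : ‖u (a (l + 1), l)‖ₑ < ⊤))
    obtain ⟨hl, hI⟩ := ha.mem_Icc_of_add_le hp.1.1 hp.2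
    have hEq : p = (a (p.2 + 1), p.2) :=
      Prod.ext (le_antisymm hI.2 (ha.left_le _ _ hp.1.2 (by omega))) rfl
    rw [hEq]
    exact Finset.single_le_sum (f := fun l => ‖u (a (l + 1), l)‖ₑ) (fun _ _ => zero_le)
      (Finset.mem_range.2 (Nat.lt_succ_of_le hl))

theorem nnnorm_le_of_jump [MeasurableSpace F] (ha : IsJumpTimes E t k a) {A : Set F}
    (hu : IsHybridInput E A u) {l : ℕ} (hl : l < k) :
    ‖u (a (l + 1), l)‖₊ ≤ (hybridNorm E u t k).toNNReal := by
  rw [← ENNReal.coe_le_coe, ENNReal.coe_toNNReal (ha.hybridNorm_ne_top hu)]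
  exact ha.enorm_le_hybridNorm_of_jump hl

theorem ae_nnnorm_le [MeasurableSpace F] (ha : IsJumpTimes E t k a) {A : Set F}
    (hu : IsHybridInput E A u) {l : ℕ} (hl : l ≤ k) :
    ∀ᵐ s, s ∈ Icc (a l) (a (l + 1)) → ‖u (s, l)‖₊ ≤ (hybridNorm E u t k).toNNReal := by
  filter_upwards [ha.ae_enorm_le_hybridNorm (u := u) hl] with s hs hsI
  rw [← ENNReal.coe_le_coe, ENNReal.coe_toNNReal (ha.hybridNorm_ne_top hu)]
  exact hs hsI

/-- A hybrid signal that stays above `R` decreases at rate `α` along flows and by `s - lam s` at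
jumps. -/
theorem decayBound (ha : IsJumpTimes E t k a) {v : ℝ × ℕ → ℝ≥0} {α lam : ℝ≥0 → ℝ≥0} {R : ℝ≥0}
    (hlam : ∀ s, lam s ≤ s)
    (hv : ∀ l ≤ k, AbsolutelyContinuousOnInterval (fun s => (v (s, l) : ℝ)) (a l) (a (l + 1)))
    (hflow : ∀ l ≤ k, ∀ᵐ s, s ∈ Icc (a l) (a (l + 1)) → R ≤ v (s, l) →
      deriv (fun s => (v (s, l) : ℝ)) s ≤ -(α (v (s, l)) : ℝ))
    (hjump : ∀ l < k, v (a (l + 1), l + 1) ≤ max (lam (v (a (l + 1), l))) R)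
    (hR : R < v (t, k)) :
    DecayBound α (v (t, k)) (v (0, 0)) t.toNNReal ∧
      DecayBound (fun s => s - lam s) (v (t, k)) (v (0, 0)) k := by
  suffices H : ∀ l ≤ k, R < v (a (l + 1), l) →
      DecayBound α (v (a (l + 1), l)) (v (0, 0)) (a (l + 1)).toNNReal ∧
        DecayBound (fun s => s - lam s) (v (a (l + 1), l)) (v (0, 0)) l by
    have := H k le_rfl
    rw [ha.last] at this
    exact this hR
  intro l
  induction l with
  | zero =>
    intro hl hR
    have h := (DecayBound.of_flow (ha.le 0 hl) (hv 0 hl) (hflow 0 hl) hR).2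
    rw [ha.zero, sub_zero] at h
    exact ⟨h, by simpa using DecayBound.of_le h.1⟩
  | succ l ih =>
    intro hl hR
    obtain ⟨hR', h⟩ := DecayBound.of_flow (ha.le _ hl) (hv _ hl) (hflow _ hl) hR
    have hj : v (a (l + 1), l + 1) ≤ lam (v (a (l + 1), l)) :=
      (le_max_iff.1 (hjump l hl)).resolve_right (not_le.2 hR')
    obtain ⟨h1, h2⟩ := ih (by omega) (hR'.trans_le (hj.trans (hlam _)))
    constructor
    -- In the time count a jump is a decrease of duration 0; in the jump count below, the flow is.
    · have := h.trans ((DecayBound.of_le (hj.trans (hlam _))).trans h1)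
      rwa [zero_add, ← Real.toNNReal_add (sub_nonneg.2 (ha.le _ hl)) (ha.nonneg (by omega)),
        sub_add_cancel] at this
    · have := (DecayBound.of_le h.1).trans ((DecayBound.of_jump (hlam _) hj).trans h2)
      have hcast : (0 : ℝ≥0) + (1 + (l : ℝ≥0)) = ((l + 1 : ℕ) : ℝ≥0) := by push_cast; ring
      rwa [hcast] at this

end IsJumpTimes

/-! ### From the Lyapunov function to ISS -/

namespace HybridSubsystem

variable {n M : ℕ} {N : Fin n → ℕ} {i : Fin n} {S : HybridSubsystem N M i} {E : Set (ℝ × ℕ)}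
  {x : ∀ j, ℝ × ℕ → EuclideanSpace ℝ (Fin (N j))} {u : ℝ × ℕ → EuclideanSpace ℝ (Fin M)}

/-- Along a solution pair, the decrease condition of a Lyapunov function holds at almost every
time of an interval of flow. -/
theorem IsSolutionPair.ae_deriv_le (h : S.IsSolutionPair E x u) (hχ : IsOpen (S.χ i))
    {V : EuclideanSpace ℝ (Fin (N i)) → ℝ} (hV : LocallyLipschitzOn (S.χ i) V)
    {P : HybridSpace N M → Prop} {α : EuclideanSpace ℝ (Fin (N i)) → ℝ}
    (hdec : ∀ z ∈ S.C, P z → ∀ ζ ∈ clarkeGradient V (z.1 i), inner ℝ ζ (S.f z) ≤ α (z.1 i))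
    {a b : ℝ} {l : ℕ} (hab : a ≤ b) (hsub : Icc a b ⊆ timeSlice E l) :
    AbsolutelyContinuousOnInterval (fun s => V (x i (s, l))) a b ∧
      ∀ᵐ s, s ∈ Icc a b → P (fun j => x j (s, l), u (s, l)) →
        deriv (fun s => V (x i (s, l))) s ≤ α (x i (s, l)) := by
  have hAC : AbsolutelyContinuousOnInterval (fun s => V (x i (s, l))) a b :=
    hV.comp_absolutelyContinuousOnInterval (h.arc.absCont l a b hab hsub) (by
      rw [uIcc_of_le hab]
      exact fun s hs => h.arc.mem _ (hsub hs))
  refine ⟨hAC, ?_⟩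
  have hfl := ae_restrict_of_ae_restrict_of_subset hsub (h.flow l)
  rw [ae_restrict_iff' measurableSet_Icc] at hfl
  have hdiff := hAC.ae_differentiableAt
  rw [uIcc_of_le hab] at hdiff
  filter_upwards [hfl, hdiff] with s hs hd hsI hP
  obtain ⟨hC, hder⟩ := hs hsI
  exact deriv_comp_le_of_clarkeGradient hχ hV hder (h.arc.mem _ (hsub hsI)) (hd hsI)
    (hdec _ hC hP)

end HybridSubsystem

theorem LocallyLipschitzOn.coe_nnreal {X : Type*} [PseudoMetricSpace X] {A : Set X} {V : X → ℝ≥0}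
    (hV : LocallyLipschitzOn A V) : LocallyLipschitzOn A fun y => (V y : ℝ) := fun _ hx => by
  obtain ⟨K, T, hT, hK⟩ := hV hx
  exact ⟨K, T, hT, hK⟩

theorem mainTheorem6 {n M : ℕ} {N : Fin n → ℕ} {i : Fin n}
    (S : HybridSubsystem N M i) (hS : S.Regular)
    (hV : ∃ V : EuclideanSpace ℝ (Fin (N i)) → ℝ≥0, S.IsISSLyapunov V) :
    S.IsISS := by
  obtain ⟨V, hVL, ⟨ψ₁, ψ₂, hψ₁, hψ₂, hψ⟩, W, γ, γu, α, lam, hW, hγ, hγu, ⟨hαc, hαp⟩,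
    ⟨hlc, hlp, hlt⟩, hC, hD⟩ := hV
  obtain ⟨φ, hφ, hφψ⟩ := hψ₁.exists_inverse
  obtain ⟨β₁, hβ₁, hα₁⟩ := exists_isClassKL_of_decayBound hαc hαp
  have hlam : ∀ s, lam s ≤ s := fun s => by
    rcases eq_or_ne s 0 with rfl | hs
    · exact hlp.1.le
    · exact (hlt s (pos_iff_ne_zero.2 hs)).le
  obtain ⟨β₂, hβ₂, hα₂⟩ := exists_isClassKL_of_decayBound (α := fun s => s - lam s)
    (continuous_id.sub hlc) ⟨by simp, fun s hs => tsub_pos_of_lt (hlt s hs)⟩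
  have hWu : ∀ j, ∃ ψ, IsClassKInf ψ ∧ (j ≠ i → ∀ y ∈ S.χ j, W j y ≤ ψ ‖y‖₊) := fun j => by
    by_cases hj : j = i
    · exact ⟨ψ₁, hψ₁, fun h => absurd hj h⟩
    · obtain ⟨ψ, hψ, hle⟩ := (hW j hj).2.upper
      exact ⟨ψ, hψ, fun _ => hle⟩
  choose ψ hψK hψW using hWu
  refine ⟨fun s t r => φ (min (β₁ (ψ₂ s) t) (β₂ (ψ₂ s) r)), fun j => φ ∘ γ j ∘ ψ j, φ ∘ γu,
    hβ₁.isClassKLL_min hβ₂ hφ.toIsClassK hψ₂.toIsClassK,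
    fun j hj => Or.inl (hφ.comp ((hγ j hj).comp (hψK j))), Or.inl (hφ.comp hγu),
    fun E x u hsol t k htk => ?_⟩
  have hφm := hφ.strictMono.monotone
  obtain ⟨a, ha⟩ := hsol.domain.exists_isJumpTimes htk
  set R : ℝ≥0 := max ((Finset.univ.erase i).sup fun j => γ j (ψ j (hybridNorm E (x j) t k).toNNReal))
    (γu (hybridNorm E u t k).toNNReal) with hRdef
  have hgain : ∀ p ∈ E, (∀ j, j ≠ i → ‖x j p‖₊ ≤ (hybridNorm E (x j) t k).toNNReal) →
      ‖u p‖₊ ≤ (hybridNorm E u t k).toNNReal →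
      max ((Finset.univ.erase i).sup fun j => γ j (W j (x j p))) (γu ‖u p‖₊) ≤ R := by
    intro p hp hx hu
    refine max_le_max (Finset.sup_mono_fun fun j hj => ?_) (hγu.strictMono.monotone hu)
    have hji := Finset.ne_of_mem_erase hj
    exact (hγ j hji).strictMono.monotone
      ((hψW j hji _ ((hsol.input_state j hji).mem p hp)).trans
        ((hψK j).strictMono.monotone (hx j hji)))
  have hV1 : ‖x i (t, k)‖₊ ≤ φ (V (x i (t, k))) := by
    rw [← hφψ ‖x i (t, k)‖₊]
    exact hφm (hψ _ (hsol.arc.mem _ htk)).1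
  by_cases hR : V (x i (t, k)) ≤ R
  · refine (hV1.trans (hφm hR)).trans (le_trans ?_ (le_max_right _ _))
    rw [hRdef, hφm.map_max]
    refine max_le_max (le_of_eq ?_) le_rfl
    -- `φ 0 = 0` covers the empty supremum, when there are no other subsystems.
    exact Finset.apply_sup_eq_sup_comp_of_linearOrder φ hφm hφ.map_zero
  · have h00 : ((0 : ℝ), 0) ∈ E :=
      ha.subset 0 (Nat.zero_le k) ⟨ha.zero.le, ha.zero.symm.le.trans (ha.le 0 (Nat.zero_le k))⟩
    have hf := fun l (hl : l ≤ k) => hsol.toIsSolutionPair.ae_deriv_le (hS.isOpen_χ i)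
      hVL.coe_nnreal (α := fun y => -(α (V y) : ℝ)) hC (ha.le l hl) (ha.subset l hl)
    obtain ⟨d1, d2⟩ := ha.decayBound (v := fun p => V (x i p)) (α := α) (R := R) hlam
      (fun l hl => (hf l hl).1) (fun l hl => by
        have hx : ∀ᵐ s, ∀ j, j ≠ i → s ∈ Icc (a l) (a (l + 1)) →
            ‖x j (s, l)‖₊ ≤ (hybridNorm E (x j) t k).toNNReal := by
          rw [ae_all_iff]
          intro j
          by_cases hj : j = i
          · exact Eventually.of_forall fun s h => absurd hj h
          · filter_upwards [ha.ae_nnnorm_le (hsol.input_state j hj) hl] with s hs _ using hs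
        filter_upwards [(hf l hl).2, hx, ha.ae_nnnorm_le hsol.input_ext hl] with s h1 h2 h3 hsI hRs
        exact h1 hsI ((hgain (s, l) (ha.subset l hl hsI) (fun j hj => h2 j hj hsI)
          (h3 hsI)).trans hRs))
      (fun l hl => by
        have hp := ha.mem_jumpPoints hl
        obtain ⟨hmem, hg⟩ := hsol.jump _ hp
        dsimp only at hg ⊢
        rw [hg]
        exact (hD _ hmem).trans (max_le_max le_rfl (hgain _ hp.1
          (fun j hj => ha.nnnorm_le_of_jump (hsol.input_state j hj) hl)
          (ha.nnnorm_le_of_jump hsol.input_ext hl))))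
      (not_le.1 hR)
    refine (hV1.trans (hφm ?_)).trans (le_max_left _ _)
    have h0 := (hψ _ (hsol.arc.mem _ h00)).2
    exact le_min ((hα₁ _ _ _ d1).trans ((hβ₁.left _).strictMono.monotone h0))
      ((hα₂ _ _ _ d2).trans ((hβ₂.left _).strictMono.monotone h0))
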